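/- Theorem. Let $P$ be a finite set of points in $\mathbb{R}^2$. A point $p$ dominates a point $q\neq p$ if $x_p\ge x_q$ and $y_p\ge y_q$; the skyline of a finite set is the set of its points not dominated by another of its points. An anti-dominance query $(a,b)\in\mathbb{R}^2$ on $P$ asks for the skyline of $P\cap\big((-\infty,a]\times(-\infty,b]\big)$, and $k$ denotes the number of points in the result. In the indexability model with block size $B$, a structure on $P$ is a collection of blocks, each a subset of $P$ with at most $B$ points, whose union is $P$; its space is the number of blocks, and the number of I/Os of a query is the least number of blocks whose union contains the result of the query. In this model a structure of linear size, i.e. of at most $cn/B$ blocks on $n$ points with a constant $c\ge 1$, must incur $\Omega((n/B)^{\varepsilon}+k/B)$ I/Os to answer an anti-dominance query in the worst case, for every constant $0<\varepsilon\le 1/(25c)$; more precisely, a query cost of $\mathcal{O}((n/B)^{\varepsilon}+k/B)$ cannot be guaranteed, whatever the hidden constant: For every $c\ge 1$ there is an integer $D$ such that for every $\varepsilon$ with $0<\varepsilon\le 1/(25c)$ and every $\alpha>0$ there is a $B_0 \ge 1$ such that for all integers $B\ge B_0$ and $n\ge B^{D}$ there is a set $P$ of $n$ points in $\mathbb{R}^2$,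 no two with the same $x$-coordinate or the same $y$-coordinate, with the following property: for every structure on $P$ with block size $B$ and at most $cn/B$ blocks there is an anti-dominance query whose number of I/Os is greater than $\alpha\big((n/B)^{\varepsilon}+k/B\big)$, where $k$ is the size of its result. -/

import Mathlib

/-- `p` dominates `q`: the points are different and `p` is at least as large as `q` in both
coordinates. -/
def Dominates (p q : ℝ × ℝ) : Prop :=
  p ≠ q ∧ q.1 ≤ p.1 ∧ q.2 ≤ p.2

open Classical in
/-- The skyline of a finite planar point set: its maximal points, i.e. the points that are not
dominated by any other point of the set. -/
noncomputable def skyline (S : Finset (ℝ × ℝ)) : Finset (ℝ × ℝ) :=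
  S.filter fun p => ∀ q ∈ S, ¬ Dominates q p

/-- The anti-dominance range `(-∞, a] × (-∞, b]`: a 2-sided rectangle whose left and bottom edges
are grounded. -/
def antiDominanceRange (a b : ℝ) : Set (ℝ × ℝ) :=
  {p | p.1 ≤ a ∧ p.2 ≤ b}

open Classical in
/-- The output of the anti-dominance range skyline query with corner `(a, b)` on `P`: the skyline
of the points of `P` inside the range. -/
noncomputable def antiDominanceQuery (P : Finset (ℝ × ℝ)) (a b : ℝ) : Finset (ℝ × ℝ) :=
  skyline (P.filter fun p => p ∈ antiDominanceRange a b)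

/-- No two points of `P` have the same `x`-coordinate or the same `y`-coordinate. -/
def GeneralPosition (P : Finset (ℝ × ℝ)) : Prop :=
  Set.InjOn Prod.fst (P : Set (ℝ × ℝ)) ∧ Set.InjOn Prod.snd (P : Set (ℝ × ℝ))

/-- A structure on the point set `P` in the indexability model with block size `B`: a finite
collection of blocks, each a set of at most `B` points of `P`, that together contain all of `P`. -/
structure IndexingScheme (P : Finset (ℝ × ℝ)) (B : ℕ) where
  /-- The blocks; a point may be stored in several of them. -/
  blocks : Finset (Finset (ℝ × ℝ))
  block_subset : ∀ b ∈ blocks, b ⊆ P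
  card_block_le : ∀ b ∈ blocks, b.card ≤ B
  covers : ∀ p ∈ P, ∃ b ∈ blocks, p ∈ b

namespace IndexingScheme

variable {P : Finset (ℝ × ℝ)} {B : ℕ}

/-- The space of a structure: its number of blocks. -/
def space (Λ : IndexingScheme P B) : ℕ := Λ.blocks.card

/-- The collection `C` of blocks of the structure answers a query with output `R`: every point of
`R` lies in a block of `C`. -/
def Answers (Λ : IndexingScheme P B) (C : Finset (Finset (ℝ × ℝ))) (R : Finset (ℝ × ℝ)) : Prop :=
  C ⊆ Λ.blocks ∧ ∀ p ∈ R, ∃ b ∈ C, p ∈ b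

/-- The number of I/Os for a query with output `R`: the least number of blocks of the structure
whose union contains `R`. -/
noncomputable def queryCost (Λ : IndexingScheme P B) (R : Finset (ℝ × ℝ)) : ℕ :=
  sInf {t : ℕ | ∃ C, Λ.Answers C R ∧ C.card = t}

/-- Query outputs can always be covered, so that `queryCost` is attained. -/
theorem exists_answers_card_eq (Λ : IndexingScheme P B) (a b : ℝ) :
    ∃ C, Λ.Answers C (antiDominanceQuery P a b) ∧
      C.card = Λ.queryCost (antiDominanceQuery P a b) := by
  have h : {t : ℕ | ∃ C, Λ.Answers C (antiDominanceQuery P a b) ∧ C.card = t}.Nonempty := by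
    refine ⟨_, Λ.blocks, ⟨Finset.Subset.refl _, fun p hp => Λ.covers p ?_⟩, rfl⟩
    unfold antiDominanceQuery skyline at hp
    simp only [Finset.mem_filter] at hp
    exact hp.1.1
  exact Nat.sInf_mem h

end IndexingScheme

/-! The hard instance is a grid with side `w ≈ n ^ (1/m)` in dimension `m = ⌈8c⌉`, drawn in the
plane with abscissae in lexicographic and ordinates in reversed colexicographic order. Along an
axis-parallel line the abscissa grows while the ordinate falls, and each such line is exactly the
output of a query (`antiDominanceQuery_gridPoint_line`). This gives `m * w ^ (m - 1)` outputs of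
size `w`, two of which share at most one point.

If all queries were cheap, each output would be covered by `O(w / B)` blocks, so half of it would
lie in blocks holding `Ω(B)` of its points. As outputs hardly overlap, a block can serve only few of
them in this way, whence `m * w ^ m ≤ 4 * B * space` (`card_mul_le_of_covers`). Linear space bounds
the right side by `4cn < 8c * w ^ m ≤ m * w ^ m`, a contradiction. -/

/-! ### Double counting of blocks against nearly disjoint outputs. -/

/-- Second moment argument: Cauchy–Schwarz for the number `d p` of sets through a point `p` of `b`.
The off-diagonal pairs add at most `m ^ 2`, which heaviness makes negligible. -/
theorem sum_card_inter_le_two_mul {ι γ : Type*} [DecidableEq γ] [DecidableEq ι]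
    (b : Finset γ) (B : ℕ) (hb : b.card ≤ B) (H : Finset ι) (Q : ι → Finset γ)
    (hQ : ∀ i j, i ≠ j → (Q i ∩ Q j).card ≤ 1) (τ : ℝ) (hτ : 0 < τ) (hB : 2 ≤ τ ^ 2 * B)
    (hH : ∀ i ∈ H, τ * B ≤ ((b ∩ Q i).card : ℝ)) :
    ∑ i ∈ H, ((b ∩ Q i).card : ℝ) ≤ 2 * B := by
  set S : ℝ := ∑ i ∈ H, ((b ∩ Q i).card : ℝ) with hS
  set m : ℝ := (H.card : ℝ) with hm
  let d : γ → ℝ := fun p => ∑ i ∈ H, if p ∈ Q i then 1 else 0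
  have hd : ∑ p ∈ b, d p = S := by
    simp only [d, hS]
    rw [Finset.sum_comm]
    refine Finset.sum_congr rfl fun i _ => ?_
    rw [Finset.sum_boole, Finset.filter_mem_eq_inter]
  have hd2 : ∑ p ∈ b, d p ^ 2 ≤ S + m ^ 2 := by
    have h1 : ∑ p ∈ b, d p ^ 2 = ∑ i ∈ H, ∑ j ∈ H, ((b ∩ (Q i ∩ Q j)).card : ℝ) := by
      simp only [d, sq, Finset.sum_mul_sum]
      rw [Finset.sum_comm]
      refine Finset.sum_congr rfl fun i _ => ?_
      rw [Finset.sum_comm]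
      refine Finset.sum_congr rfl fun j _ => ?_
      rw [← Finset.filter_mem_eq_inter, ← Finset.sum_boole]
      refine Finset.sum_congr rfl fun p _ => ?_
      by_cases h1 : p ∈ Q i <;> by_cases h2 : p ∈ Q j <;> simp [h1, h2]
    have h2 : ∀ i ∈ H, ∑ j ∈ H, ((b ∩ (Q i ∩ Q j)).card : ℝ) ≤ ((b ∩ Q i).card : ℝ) + m := by
      intro i hi
      rw [← Finset.add_sum_erase H _ hi, Finset.inter_self]
      gcongr
      calc ∑ j ∈ H.erase i, ((b ∩ (Q i ∩ Q j)).card : ℝ) ≤ ∑ j ∈ H.erase i, (1 : ℝ) := by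
            refine Finset.sum_le_sum fun j hj => ?_
            exact_mod_cast (Finset.card_le_card Finset.inter_subset_right).trans
              (hQ i j (Finset.ne_of_mem_erase hj).symm)
        _ ≤ m := by
            simp only [Finset.sum_const, nsmul_eq_mul, mul_one, hm]
            exact_mod_cast Finset.card_le_card (Finset.erase_subset i H)
    rw [h1]
    refine (Finset.sum_le_sum h2).trans ?_
    rw [Finset.sum_add_distrib, Finset.sum_const, nsmul_eq_mul, sq]
  have hcs : S ^ 2 ≤ (b.card : ℝ) * ∑ p ∈ b, d p ^ 2 := by
    rw [← hd]; exact sq_sum_le_card_mul_sum_sq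
  have hmS : m * (τ * B) ≤ S := by
    rw [hS, hm, ← nsmul_eq_mul]; exact Finset.card_nsmul_le_sum _ _ _ hH
  have hS0 : 0 ≤ S := Finset.sum_nonneg fun _ _ => Nat.cast_nonneg _
  have hm0 : 0 ≤ m := Nat.cast_nonneg _
  have hB0 : (0 : ℝ) ≤ B := Nat.cast_nonneg _
  have hS2 : S ^ 2 ≤ B * (S + m ^ 2) := hcs.trans <|
    mul_le_mul (by exact_mod_cast hb) hd2 (Finset.sum_nonneg fun _ _ => sq_nonneg _) hB0
  have hBm : 2 * (B * m ^ 2) ≤ S ^ 2 := by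
    calc 2 * (B * m ^ 2) ≤ τ ^ 2 * B * (B * m ^ 2) := by gcongr
      _ = (m * (τ * B)) ^ 2 := by ring
      _ ≤ S ^ 2 := by gcongr
  -- Together, `S ^ 2 ≤ B * S + S ^ 2 / 2`; it remains to divide by `S`.
  rcases hS0.eq_or_lt with h0 | h0
  · rw [← h0]; positivity
  · nlinarith

/-- A redundancy bound in the indexability model. -/
theorem card_mul_le_of_covers {ι γ : Type*} [Fintype ι] [DecidableEq ι] [DecidableEq γ]
    (blocks : Finset (Finset γ)) (B k : ℕ) (hblocks : ∀ b ∈ blocks, b.card ≤ B)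
    (Q : ι → Finset γ) (hcard : ∀ i, (Q i).card = k)
    (hQ : ∀ i j, i ≠ j → (Q i ∩ Q j).card ≤ 1) (α : ℝ) (hα : 0 < α) (hB : 32 * α ^ 2 ≤ B)
    (C : ι → Finset (Finset γ)) (hC : ∀ i, C i ⊆ blocks)
    (hcov : ∀ i, ∀ p ∈ Q i, ∃ b ∈ C i, p ∈ b)
    (hCcard : ∀ i, ((C i).card : ℝ) * B ≤ 2 * α * k) :
    (Fintype.card ι : ℝ) * k ≤ 4 * B * blocks.card := by
  -- With this threshold the light blocks of a cover hold at most `τ * 2αk = k / 2` points of the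
  -- output.
  set τ : ℝ := 1 / (4 * α) with hτdef
  have hτ : 0 < τ := by positivity
  have hB' : 2 ≤ τ ^ 2 * B := by
    have : τ ^ 2 * (32 * α ^ 2) = 2 := by rw [hτdef]; field_simp; norm_num
    rw [← this]; gcongr
  let heavy : ι → Finset γ → Prop := fun i b => τ * B ≤ ((b ∩ Q i).card : ℝ)
  classical
  have hquery : ∀ i, (k : ℝ) / 2 ≤ ∑ b ∈ blocks with heavy i b, ((b ∩ Q i).card : ℝ) := by
    intro i
    have h1 : (k : ℝ) ≤ ∑ b ∈ C i, ((b ∩ Q i).card : ℝ) := by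
      rw [← hcard i]
      have : Q i ⊆ (C i).biUnion fun b => b ∩ Q i := by
        intro p hp
        obtain ⟨b, hb, hpb⟩ := hcov i p hp
        exact Finset.mem_biUnion.2 ⟨b, hb, Finset.mem_inter.2 ⟨hpb, hp⟩⟩
      exact_mod_cast (Finset.card_le_card this).trans Finset.card_biUnion_le
    have h2 : ∑ b ∈ C i with ¬ heavy i b, ((b ∩ Q i).card : ℝ) ≤ k / 2 := by
      calc ∑ b ∈ C i with ¬ heavy i b, ((b ∩ Q i).card : ℝ)
          ≤ ∑ b ∈ C i with ¬ heavy i b, τ * B :=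
            Finset.sum_le_sum fun b hb => (not_le.1 (Finset.mem_filter.1 hb).2).le
        _ ≤ ∑ b ∈ C i, τ * B :=
            Finset.sum_le_sum_of_subset_of_nonneg (Finset.filter_subset _ _)
              fun _ _ _ => by positivity
        _ = τ * ((C i).card * B) := by rw [Finset.sum_const, nsmul_eq_mul]; ring
        _ ≤ τ * (2 * α * k) := mul_le_mul_of_nonneg_left (hCcard i) hτ.le
        _ = k / 2 := by rw [hτdef]; field_simp; norm_num
    have h3 : ∑ b ∈ C i with heavy i b, ((b ∩ Q i).card : ℝ)
        ≤ ∑ b ∈ blocks with heavy i b, ((b ∩ Q i).card : ℝ) :=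
      Finset.sum_le_sum_of_subset_of_nonneg (Finset.filter_subset_filter _ (hC i))
        fun _ _ _ => Nat.cast_nonneg _
    rw [← Finset.sum_filter_add_sum_filter_not (C i) (heavy i)] at h1
    linarith
  have hsum : (Fintype.card ι : ℝ) * (k / 2) ≤ 2 * B * blocks.card := by
    calc (Fintype.card ι : ℝ) * (k / 2) = ∑ _i : ι, (k : ℝ) / 2 := by simp
      _ ≤ ∑ i, ∑ b ∈ blocks with heavy i b, ((b ∩ Q i).card : ℝ) :=
          Finset.sum_le_sum fun i _ => hquery i
      _ = ∑ b ∈ blocks, ∑ i with heavy i b, ((b ∩ Q i).card : ℝ) := by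
          simp only [Finset.sum_filter]; exact Finset.sum_comm
      _ ≤ ∑ b ∈ blocks, 2 * (B : ℝ) := Finset.sum_le_sum fun b hb =>
          sum_card_inter_le_two_mul b B (hblocks b hb) _ Q hQ τ hτ hB'
            fun i hi => (Finset.mem_filter.1 hi).2
      _ = 2 * B * blocks.card := by rw [Finset.sum_const, nsmul_eq_mul]; ring
  linarith

/-! ### Grid lines as skylines. -/

/-- Both bounds agree with `f` before `j`, so they squeeze the coordinates of `h` one after another.
With the colexicographic analogue, a vertex between two points of a line in both orders is on that
line. -/
theorem Pi.Lex.eq_below_of_between_update {ι α : Type*} [LinearOrder ι] [WellFoundedLT ι]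
    [LinearOrder α] {f h : ι → α} {j : ι} {v w : α}
    (h₁ : toLex (Function.update f j v) ≤ toLex h)
    (h₂ : toLex h ≤ toLex (Function.update f j w)) : ∀ i < j, h i = f i := by
  intro i
  induction i using WellFoundedLT.induction with
  | ind i ih =>
    intro hij
    have below : ∀ (u : α), ∀ l < i, h l = Function.update f j u l := fun u l hl => by
      rw [Function.update_of_ne (hl.trans hij).ne]; exact ih l hl (hl.trans hij)
    have a := Pi.apply_le_of_toLex h₁ fun l hl => (below v l hl).symm
    have b := Pi.apply_le_of_toLex h₂ (below w)
    rw [Function.update_of_ne hij.ne] at a b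
    exact le_antisymm b a

theorem Pi.Colex.eq_above_of_between_update {ι α : Type*} [LinearOrder ι] [WellFoundedGT ι]
    [LinearOrder α] {f h : ι → α} {j : ι} {v w : α}
    (h₁ : toColex (Function.update f j v) ≤ toColex h)
    (h₂ : toColex h ≤ toColex (Function.update f j w)) : ∀ i > j, h i = f i := by
  intro i
  induction i using WellFoundedGT.induction with
  | ind i ih =>
    intro hij
    have above : ∀ (u : α), ∀ l > i, h l = Function.update f j u l := fun u l hl => by
      rw [Function.update_of_ne (hij.trans hl).ne']; exact ih l hl (hij.trans hl)
    have a := Pi.apply_le_of_toColex h₁ fun l hl => (above v l hl).symm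
    have b := Pi.apply_le_of_toColex h₂ (above w)
    rw [Function.update_of_ne hij.ne'] at a b
    exact le_antisymm b a

theorem mem_antiDominanceQuery {P : Finset (ℝ × ℝ)} {a b : ℝ} {p : ℝ × ℝ} :
    p ∈ antiDominanceQuery P a b ↔ (p ∈ P ∧ p.1 ≤ a ∧ p.2 ≤ b) ∧
      ∀ q ∈ P, q.1 ≤ a → q.2 ≤ b → ¬ Dominates q p := by
  have hmem : ∀ S : Finset (ℝ × ℝ), p ∈ skyline S ↔ p ∈ S ∧ ∀ q ∈ S, ¬ Dominates q p :=
    fun _ => @Finset.mem_filter _ _ (_) _ _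
  have hrange : ∀ q : ℝ × ℝ, q ∈ antiDominanceRange a b ↔ q.1 ≤ a ∧ q.2 ≤ b := fun _ => Iff.rfl
  rw [antiDominanceQuery, hmem]
  simp only [Finset.mem_filter, hrange, and_imp]

/-- The planar point of a grid vertex: its abscissa follows the lexicographic order, its ordinate
the reverse of the colexicographic order. -/
def gridPoint {ι α : Type*} (r : Lex (ι → α) → ℝ) (s : Colex (ι → α) → ℝ) (f : ι → α) : ℝ × ℝ :=
  (r (toLex f), -s (toColex f))

theorem gridPoint_injective {ι α : Type*} {r : Lex (ι → α) → ℝ} (hr : Function.Injective r)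
    (s : Colex (ι → α) → ℝ) : Function.Injective (gridPoint r s) := fun _ _ h =>
  toLex_inj.1 (hr (Prod.ext_iff.1 h).1)

/-- Every axis-parallel line of the grid is the output of an anti-dominance query. -/
theorem antiDominanceQuery_gridPoint_line {ι α : Type*} [LinearOrder ι] [Finite ι] [LinearOrder α]
    [BoundedOrder α] [Fintype α] {r : Lex (ι → α) → ℝ} (hr : StrictMono r)
    {s : Colex (ι → α) → ℝ} (hs : StrictMono s) {P : Finset (ℝ × ℝ)}
    (hP : ∀ f, gridPoint r s f ∈ P)
    (hP' : ∀ p ∈ P, (∃ f, gridPoint r s f = p) ∨ ∀ f, -s (toColex f) < p.2) (f : ι → α) (j : ι) :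
    antiDominanceQuery P (r (toLex (Function.update f j ⊤))) (-s (toColex (Function.update f j ⊥)))
      = Finset.univ.image fun v => gridPoint r s (Function.update f j v) := by
  have lexle : ∀ v w : α, toLex (Function.update f j v) ≤ toLex (Function.update f j w) ↔ v ≤ w :=
    fun v w => by
      have := Pi.le_toLex_update_self_iff (x := Function.update f j v) (i := j) (a := w)
      simpa using this
  have colexle : ∀ v w : α,
      toColex (Function.update f j v) ≤ toColex (Function.update f j w) ↔ v ≤ w := fun v w => by
    have := Pi.le_toColex_update_self_iff (x := Function.update f j v) (i := j) (a := w)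
    simpa using this
  have inRange : ∀ v, (gridPoint r s (Function.update f j v)).1 ≤ r (toLex (Function.update f j ⊤))
      ∧ (gridPoint r s (Function.update f j v)).2 ≤ -s (toColex (Function.update f j ⊥)) := fun v =>
    ⟨hr.monotone ((lexle _ _).2 le_top), neg_le_neg (hs.monotone ((colexle _ _).2 bot_le))⟩
  have eqUpdate : ∀ (h : ι → α) (v w v' w' : α),
      toLex (Function.update f j v) ≤ toLex h → toLex h ≤ toLex (Function.update f j w) →
      toColex (Function.update f j v') ≤ toColex h → toColex h ≤ toColex (Function.update f j w') →
      h = Function.update f j (h j) := by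
    intro h v w v' w' h₁ h₂ h₃ h₄
    funext i
    rcases lt_trichotomy i j with hij | rfl | hij
    · rw [Function.update_of_ne hij.ne, Pi.Lex.eq_below_of_between_update h₁ h₂ i hij]
    · simp
    · rw [Function.update_of_ne hij.ne', Pi.Colex.eq_above_of_between_update h₃ h₄ i hij]
  ext p
  simp only [mem_antiDominanceQuery, Finset.mem_image, Finset.mem_univ, true_and]
  constructor
  · rintro ⟨⟨hp, hpa, hpb⟩, hmax⟩
    rcases hP' p hp with ⟨h, rfl⟩ | hout
    · refine ⟨h j, congrArg _ (eqUpdate h ⊥ ⊤ ⊥ ⊤ ?_ ?_ ?_ ?_).symm⟩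
      -- Otherwise the `⊥` end of the line, whose ordinate is that of the corner, dominates `h`;
      -- below, the `⊤` end plays this role for the other coordinate.
      · by_contra hlt
        have hlt := hr (not_le.1 hlt)
        exact hmax _ (hP _) (inRange ⊥).1 (inRange ⊥).2
          ⟨fun e => hlt.ne' (Prod.ext_iff.1 e).1, hlt.le, hpb⟩
      · exact hr.le_iff_le.1 hpa
      · exact hs.le_iff_le.1 (neg_le_neg_iff.1 hpb)
      · by_contra hlt
        have hlt := neg_lt_neg (hs (not_le.1 hlt))
        exact hmax _ (hP _) (inRange ⊤).1 (inRange ⊤).2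
          ⟨fun e => hlt.ne' (Prod.ext_iff.1 e).2, hpa, hlt.le⟩
    · exact absurd hpb (hout _).not_ge
  · rintro ⟨v, rfl⟩
    refine ⟨⟨hP _, inRange v⟩, fun q hq hqa hqb hdom => ?_⟩
    rcases hP' q hq with ⟨h, rfl⟩ | hout
    · have h₁ := hr.le_iff_le.1 hdom.2.1
      have h₂ := hs.le_iff_le.1 (neg_le_neg_iff.1 hdom.2.2)
      -- A dominating vertex would be on the same line, where the two orders run oppositely.
      have he := eqUpdate h v ⊤ ⊥ v h₁ (hr.le_iff_le.1 hqa)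
        (hs.le_iff_le.1 (neg_le_neg_iff.1 hqb)) h₂
      rw [he] at h₁ h₂
      have : h j = v := le_antisymm ((colexle _ _).1 h₂) ((lexle _ _).1 h₁)
      rw [this] at he
      exact hdom.1 (congrArg _ he)
    · exact absurd hqb (hout _).not_ge

theorem exists_strictMono_real (β : Type*) [LinearOrder β] [Finite β] :
    ∃ r : β → ℝ, StrictMono r := by
  have := Fintype.ofFinite β
  let e := (Fintype.orderIsoFinOfCardEq β rfl).symm
  exact ⟨fun b => ((e b : ℕ) : ℝ), fun a b h => Nat.cast_lt.2 (Fin.lt_def.1 (e.strictMono h))⟩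

/-- A finite set in general position extends to any larger cardinality, by points above it. -/
theorem GeneralPosition.exists_extension {P : Finset (ℝ × ℝ)} (hP : GeneralPosition P) {n : ℕ}
    (hn : P.card ≤ n) : ∃ P' : Finset (ℝ × ℝ), P'.card = n ∧ GeneralPosition P' ∧ P ⊆ P' ∧
      ∀ p ∈ P', p ∈ P ∨ ∀ q ∈ P, q.2 < p.2 := by
  obtain ⟨k, rfl⟩ := Nat.exists_eq_add_of_le hn
  clear hn
  induction k with
  | zero => exact ⟨P, rfl, hP, subset_rfl, fun p hp => Or.inl hp⟩
  | succ k ih =>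
    obtain ⟨P', hcard, hgp, hsub, habove⟩ := ih
    obtain ⟨x, hx⟩ := (P'.image Prod.fst).finite_toSet.bddAbove
    obtain ⟨y, hy⟩ := (P'.image Prod.snd).finite_toSet.bddAbove
    have hx' : ∀ p ∈ P', p.1 < x + 1 := fun p hp =>
      (hx (Finset.mem_image_of_mem _ hp)).trans_lt (lt_add_one x)
    have hy' : ∀ p ∈ P', p.2 < y + 1 := fun p hp =>
      (hy (Finset.mem_image_of_mem _ hp)).trans_lt (lt_add_one y)
    have hnot : (x + 1, y + 1) ∉ P' := fun h => (hx' _ h).false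
    refine ⟨insert (x + 1, y + 1) P', ?_, ⟨?_, ?_⟩, hsub.trans (Finset.subset_insert _ _), ?_⟩
    · rw [Finset.card_insert_of_notMem hnot, hcard]; rfl
    · rw [Finset.coe_insert, Set.injOn_insert (by simpa using hnot)]
      refine ⟨hgp.1, ?_⟩
      rintro ⟨p, hp, hpx⟩
      exact (hx' p hp).ne hpx
    · rw [Finset.coe_insert, Set.injOn_insert (by simpa using hnot)]
      refine ⟨hgp.2, ?_⟩
      rintro ⟨p, hp, hpy⟩
      exact (hy' p hp).ne hpy
    · intro p hp
      rcases Finset.mem_insert.1 hp with rfl | hp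
      · exact Or.inr fun q hq => hy' q (hsub hq)
      · exact habove p hp

/-- Requiring the base point to have coordinate `o` in the line's direction indexes each line once.
Distinct parallel lines are disjoint; for different directions, the second line fixes the coordinate
that is free on the first. -/
theorem card_inter_lines_le_one {ι α β : Type*} [DecidableEq ι] [Fintype α] [DecidableEq β]
    {pt : (ι → α) → β} (hpt : Function.Injective pt) (o : α)
    (L M : {l : ι × (ι → α) // l.2 l.1 = o}) (hLM : L ≠ M) :
    ((Finset.univ.image fun v => pt (Function.update L.1.2 L.1.1 v)) ∩
      (Finset.univ.image fun v => pt (Function.update M.1.2 M.1.1 v))).card ≤ 1 := by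
  obtain ⟨⟨i, f⟩, hf⟩ := L
  obtain ⟨⟨j, g⟩, hg⟩ := M
  simp only at hf hg
  refine Finset.card_le_one.2 fun p hp q hq => ?_
  simp only [Finset.mem_inter, Finset.mem_image, Finset.mem_univ, true_and] at hp hq
  obtain ⟨⟨v, rfl⟩, v', hv⟩ := hp
  obtain ⟨⟨w, rfl⟩, w', hw⟩ := hq
  have hv := hpt hv
  have hw := hpt hw
  by_cases hij : i = j
  · subst hij
    suffices hfg : f = g by subst hfg; exact absurd rfl hLM
    funext l
    by_cases hl : l = i
    · subst hl; exact hf.trans hg.symm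
    · simpa [hl] using (congrFun hv l).symm
  · have h1 := congrFun hv i
    have h2 := congrFun hw i
    simp only [Function.update_self, Function.update_of_ne hij] at h1 h2
    rw [← h1, ← h2]

/-- There is a point set on which many anti-dominance queries have outputs of a given size that
pairwise share at most one point. -/
theorem exists_pointSet_queries (m w n : ℕ) (hw : 0 < w) (hn : w ^ m ≤ n) :
    ∃ P : Finset (ℝ × ℝ), P.card = n ∧ GeneralPosition P ∧
      ∃ (κ : Type) (_ : Fintype κ) (_ : DecidableEq κ) (a b : κ → ℝ),
        m * w ^ m ≤ Fintype.card κ * w ∧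
        (∀ i, (antiDominanceQuery P (a i) (b i)).card = w) ∧
        ∀ i j, i ≠ j →
          (antiDominanceQuery P (a i) (b i) ∩ antiDominanceQuery P (a j) (b j)).card ≤ 1 := by
  obtain ⟨w, rfl⟩ := Nat.exists_eq_succ_of_ne_zero hw.ne'
  let V := Fin m → Fin (w + 1)
  obtain ⟨r, hr⟩ := exists_strictMono_real (Lex V)
  have : Finite (Colex V) := inferInstanceAs (Finite V)
  obtain ⟨s, hs⟩ := exists_strictMono_real (Colex V)
  have hinj : Function.Injective (gridPoint r s) := gridPoint_injective hr.injective s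
  have hgp : GeneralPosition (Finset.univ.image (gridPoint r s)) := by
    constructor
    · intro p hp q hq h
      simp only [Finset.coe_image, Finset.coe_univ, Set.image_univ, Set.mem_range] at hp hq
      obtain ⟨f, rfl⟩ := hp
      obtain ⟨g, rfl⟩ := hq
      exact congrArg _ (toLex_inj.1 (hr.injective h))
    · intro p hp q hq h
      simp only [Finset.coe_image, Finset.coe_univ, Set.image_univ, Set.mem_range] at hp hq
      obtain ⟨f, rfl⟩ := hp
      obtain ⟨g, rfl⟩ := hq
      exact congrArg _ (toColex_inj.1 (hs.injective (neg_injective h)))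
  obtain ⟨P, hcard, hP, hsub, habove⟩ := hgp.exists_extension (n := n) (by
    rw [Finset.card_image_of_injective _ hinj]; simpa using hn)
  have hline := antiDominanceQuery_gridPoint_line hr hs
    (fun f => hsub (Finset.mem_image_of_mem _ (Finset.mem_univ f)))
    (fun p hp => (habove p hp).imp (fun h => by simpa using h)
      fun h f => h _ (Finset.mem_image_of_mem (gridPoint r s) (Finset.mem_univ f)))
  refine ⟨P, hcard, hP, {l : Fin m × V // l.2 l.1 = ⊥}, inferInstance, inferInstance,
    fun l => r (toLex (Function.update l.1.2 l.1.1 ⊤)),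
    fun l => -s (toColex (Function.update l.1.2 l.1.1 ⊥)), ?_, fun l => ?_, fun l l' hl => ?_⟩
  -- Every vertex lies on a line in each direction, which bounds the number of lines from below.
  · have hsurj : Function.Surjective
        fun x : {l : Fin m × V // l.2 l.1 = ⊥} × Fin (w + 1) =>
          (x.1.1.1, Function.update x.1.1.2 x.1.1.1 x.2) := fun ⟨j, h⟩ =>
      ⟨(⟨(j, Function.update h j ⊥), by simp⟩, h j), by simp⟩
    simpa [V] using Fintype.card_le_of_surjective _ hsurj
  · rw [hline, Finset.card_image_of_injective]
    · simp
    · exact hinj.comp (Function.update_injective _ _)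
  · rw [hline, hline]
    exact card_inter_lines_le_one hinj ⊥ l l' hl

/-- The parameters of the construction: `w ^ m` exhausts half of `n`, while `w` is still
polynomially larger than `B`. -/
theorem exists_root_of_pow_le {c : ℝ} (hc : 1 ≤ c) {ε : ℝ} (hε0 : 0 < ε) (hε : ε ≤ 1 / (25 * c))
    {B n : ℕ} (hB : 2 * ⌈8 * c⌉₊ ≤ B) (hn : B ^ ⌈50 * c⌉₊ ≤ n) :
    ∃ w : ℕ, (B : ℝ) * ((n : ℝ) / B) ^ ε ≤ w ∧ 0 < w ∧ w ^ ⌈8 * c⌉₊ ≤ n ∧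
      (n : ℝ) < 2 * (w : ℝ) ^ ⌈8 * c⌉₊ := by
  have hc0 : 0 < c := by linarith
  set m := ⌈8 * c⌉₊ with hm
  have hm8 : 8 * c ≤ m := Nat.le_ceil _
  have hm9 : (m : ℝ) ≤ 9 * c := by
    have := Nat.ceil_lt_add_one (a := 8 * c) (by positivity)
    linarith
  have hm0 : 0 < m := by
    have : (0 : ℝ) < m := by linarith
    exact_mod_cast this
  have hB2 : 2 ≤ B := by omega
  have hB2' : (2 : ℝ) ≤ B := by exact_mod_cast hB2
  have hD0 : 0 < ⌈50 * c⌉₊ := Nat.ceil_pos.2 (by positivity)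
  have hBn : B ≤ n := (Nat.le_self_pow hD0.ne' B).trans hn
  have hBn' : (B : ℝ) ≤ n := by exact_mod_cast hBn
  have hn1 : (1 : ℝ) ≤ n := by linarith
  have hn0 : (0 : ℝ) ≤ n := by linarith
  set δ : ℝ := 1 / (50 * c) with hδ
  have hBδ : (B : ℝ) ≤ (n : ℝ) ^ δ := by
    have h1 : ((B : ℝ) ^ ⌈50 * c⌉₊) ≤ n := by exact_mod_cast hn
    have h2 : (B : ℝ) ≤ (n : ℝ) ^ ((⌈50 * c⌉₊ : ℝ)⁻¹) := by
      rw [← Real.pow_rpow_inv_natCast (by positivity : (0 : ℝ) ≤ B) hD0.ne']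
      exact Real.rpow_le_rpow (by positivity) h1 (by positivity)
    refine h2.trans (Real.rpow_le_rpow_of_exponent_le hn1 ?_)
    rw [hδ, one_div]
    exact inv_anti₀ (by positivity) (Nat.le_ceil _)
  have hεδ : ε ≤ 2 * δ := by
    refine hε.trans_eq ?_
    rw [hδ]; field_simp; norm_num
  have hX : ((n : ℝ) / B) ^ ε ≤ (n : ℝ) ^ (2 * δ) :=
    (Real.rpow_le_rpow (by positivity) (div_le_self hn0 (by linarith)) hε0.le).trans
      (Real.rpow_le_rpow_of_exponent_le hn1 hεδ)
  have hX1 : 1 ≤ ((n : ℝ) / B) ^ ε :=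
    Real.one_le_rpow ((one_le_div (by positivity)).2 hBn') hε0.le
  set w := ⌊(n : ℝ) ^ ((m : ℝ)⁻¹)⌋₊ with hw
  have hroot0 : 0 ≤ (n : ℝ) ^ ((m : ℝ)⁻¹) := by positivity
  have hwle : (w : ℝ) ≤ (n : ℝ) ^ ((m : ℝ)⁻¹) := Nat.floor_le hroot0
  have hltw : (n : ℝ) ^ ((m : ℝ)⁻¹) < w + 1 := Nat.lt_floor_add_one _
  have hBw : (B : ℝ) * ((n : ℝ) / B) ^ ε ≤ w := by
    -- The three factors bound `2`, `B` and `(n / B) ^ ε`; the spare `2` pays for rounding the root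
    -- down to `w`.
    have h4 : (n : ℝ) ^ δ * ((n : ℝ) ^ δ * (n : ℝ) ^ (2 * δ)) = (n : ℝ) ^ (4 * δ) := by
      rw [← Real.rpow_add (by linarith), ← Real.rpow_add (by linarith)]; congr 1; ring
    have h5 : (n : ℝ) ^ (4 * δ) ≤ (n : ℝ) ^ ((m : ℝ)⁻¹) := by
      refine Real.rpow_le_rpow_of_exponent_le hn1 ?_
      calc 4 * δ ≤ (9 * c)⁻¹ := by
            rw [hδ, inv_eq_one_div, mul_one_div, div_le_div_iff₀ (by positivity) (by positivity)]
            linarith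
        _ ≤ (m : ℝ)⁻¹ := inv_anti₀ (by exact_mod_cast hm0) hm9
    have h6 : 2 * ((B : ℝ) * ((n : ℝ) / B) ^ ε)
        ≤ (n : ℝ) ^ δ * ((n : ℝ) ^ δ * (n : ℝ) ^ (2 * δ)) := by
      have := hB2'.trans hBδ
      gcongr
    have h7 : 1 ≤ (B : ℝ) * ((n : ℝ) / B) ^ ε := by nlinarith
    linarith
  have hBw' : (B : ℝ) ≤ w := (le_mul_of_one_le_right (by positivity) hX1).trans hBw
  have hw0 : (0 : ℝ) < w := by linarith
  refine ⟨w, hBw, by exact_mod_cast hw0, ?_, ?_⟩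
  · have : (w : ℝ) ^ m ≤ n := by
      calc (w : ℝ) ^ m ≤ ((n : ℝ) ^ ((m : ℝ)⁻¹)) ^ m := by gcongr
        _ = n := Real.rpow_inv_natCast_pow hn0 hm0.ne'
    exact_mod_cast this
  · have h1 : (n : ℝ) < ((w : ℝ) + 1) ^ m := by
      calc (n : ℝ) = ((n : ℝ) ^ ((m : ℝ)⁻¹)) ^ m := (Real.rpow_inv_natCast_pow hn0 hm0.ne').symm
        _ < _ := by gcongr
    have h2mw : 2 * (m : ℝ) ≤ w := by
      have : (2 * m : ℝ) ≤ B := by exact_mod_cast hB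
      linarith
    -- By Bernoulli's inequality, rounding costs at most a factor `2` in the `m`-th power, as `w ≥
    -- 2m`.
    have hbern : (1 : ℝ) / 2 ≤ ((w : ℝ) / (w + 1)) ^ m := by
      have h := one_add_mul_le_pow (a := -(1 / ((w : ℝ) + 1)))
        (by have : 1 / ((w : ℝ) + 1) ≤ 1 := by rw [div_le_one (by positivity)]; linarith
            linarith) m
      have e : 1 + -(1 / ((w : ℝ) + 1)) = w / (w + 1) := by field_simp; ring
      rw [e] at h
      refine le_trans ?_ h
      have : (m : ℝ) * (1 / ((w : ℝ) + 1)) ≤ 1 / 2 := by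
        rw [mul_one_div, div_le_div_iff₀ (by positivity) (by norm_num)]; linarith
      linarith
    rw [div_pow, div_le_div_iff₀ (by norm_num) (by positivity)] at hbern
    linarith

theorem mainTheorem3 (c : ℝ) (hc : 1 ≤ c) :
    ∃ D : ℕ, ∀ ε : ℝ, 0 < ε → ε ≤ 1 / (25 * c) → ∀ α : ℝ, 0 < α →
      ∃ B₀ : ℕ, 1 ≤ B₀ ∧ ∀ B : ℕ, B₀ ≤ B → ∀ n : ℕ, B ^ D ≤ n →
        ∃ P : Finset (ℝ × ℝ), P.card = n ∧ GeneralPosition P ∧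
          ∀ Λ : IndexingScheme P B, (Λ.space : ℝ) ≤ c * ((n : ℝ) / (B : ℝ)) →
            ∃ a b : ℝ,
              α * (((n : ℝ) / (B : ℝ)) ^ ε + ((antiDominanceQuery P a b).card : ℝ) / (B : ℝ))
                < (Λ.queryCost (antiDominanceQuery P a b) : ℝ) := by
  -- In the bound on `B`, the first summand serves the rounding of `w`, the second the redundancy
  -- bound.
  refine ⟨⌈50 * c⌉₊, fun ε hε0 hε α hα => ⟨2 * ⌈8 * c⌉₊ + ⌈32 * α ^ 2⌉₊, ?_, ?_⟩⟩
  · have : 0 < ⌈8 * c⌉₊ := Nat.ceil_pos.2 (by linarith)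
    omega
  intro B hB n hn
  have hm0 : 0 < ⌈8 * c⌉₊ := Nat.ceil_pos.2 (by linarith)
  have hB0 : (0 : ℝ) < B := by
    have : 0 < B := by omega
    exact_mod_cast this
  obtain ⟨w, hBw, hw0, hwn, hnw⟩ := exists_root_of_pow_le hc hε0 hε (B := B) (by omega) hn
  obtain ⟨P, hcard, hP, κ, _, _, a, b, hκ, hQ, hinter⟩ :=
    exists_pointSet_queries ⌈8 * c⌉₊ w n hw0 hwn
  refine ⟨P, hcard, hP, fun Λ hΛ => ?_⟩
  by_contra! hcost
  choose C hC hCcard using fun i => Λ.exists_answers_card_eq (a i) (b i)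
  have key := card_mul_le_of_covers Λ.blocks B w Λ.card_block_le
    (fun i => antiDominanceQuery P (a i) (b i)) hQ hinter α hα
    ((Nat.le_ceil _).trans (by exact_mod_cast (Nat.le_add_left _ _).trans hB))
    C (fun i => (hC i).1) (fun i => (hC i).2) fun i => by
      have h := hcost (a i) (b i)
      rw [← hCcard i, hQ i] at h
      calc ((C i).card : ℝ) * B ≤ α * (((n : ℝ) / B) ^ ε + w / B) * B := by gcongr
        _ = α * (B * ((n : ℝ) / B) ^ ε + w) := by field_simp
        -- As `w ≥ B * (n / B) ^ ε`, the output term dominates the additive search term.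
        _ ≤ α * (w + w) := by gcongr
        _ = 2 * α * w := by ring
  have hspace : 4 * (B : ℝ) * Λ.blocks.card ≤ 4 * c * n := by
    calc 4 * (B : ℝ) * Λ.blocks.card ≤ 4 * (B : ℝ) * (c * ((n : ℝ) / B)) := by
          gcongr; exact hΛ
      _ = 4 * c * n := by field_simp
  have hκ' : (⌈8 * c⌉₊ : ℝ) * (w : ℝ) ^ ⌈8 * c⌉₊ ≤ Fintype.card κ * w := by exact_mod_cast hκ
  have hlow : 8 * c * (w : ℝ) ^ ⌈8 * c⌉₊ ≤ (⌈8 * c⌉₊ : ℝ) * (w : ℝ) ^ ⌈8 * c⌉₊ := by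
    gcongr; exact Nat.le_ceil _
  have hlt : 4 * c * n < 4 * c * (2 * (w : ℝ) ^ ⌈8 * c⌉₊) := by gcongr
  linarith
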